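/- Let $p$ be a prime and write $H^i(\,\cdot\,)=H^i(\,\cdot\,,\mathbb Z/p)$ for profinite cohomology with trivial action. Let $\Omega$ be a nonempty family of central extensions of profinite groups $$\omega:\quad 0\to\mathbb Z/p\to \mathbb U_\omega\xrightarrow{\lambda_\omega}\bar{\mathbb U}_\omega\to 1$$ such that for every $\omega\in\Omega$: (I) there are finitely many continuous homomorphisms $\gamma_i\colon\bar{\mathbb U}_\omega\to\mathbb U_\omega$ with $\bigcap_i\ker\gamma_i=1$; (II) $\mathbb Z/p$ embeds in $\bar{\mathbb U}_\omega$. Let $\alpha_\omega\in H^2(\bar{\mathbb U}_\omega)$ be the classifying element of $\omega$. For a profinite group $G$ let $T(G)$ (resp. $\bar T(G)$) be the intersection of the kernels of all continuous homomorphisms $G\to\mathbb U_\omega$ (resp. $G\to\bar{\mathbb U}_\omega$), $\omega\in\Omega$. For a closed normal subgroup $N\le\bar T(G)$ with projection $\pi\colon G\to G/N$, a continuous homomorphism $\bar\rho\colon G/N\to\bar{\mathbb U}_\omega$ is $\pi$-liftable if $\bar\rho\circ\pi=\lambda_\omega\circ\rho$ for some continuous homomorphism $\rho\colon G\to\mathbb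 U_\omega$. Let $H^2(G/N)_\pi$ be the subgroup of $H^2(G/N)$ generated by the $\pi$-liftable pullbacks, i.e. the elements $\bar\rho^*(\alpha_\omega)$ with $\omega\in\Omega$ and $\bar\rho$ $\pi$-liftable. For closed normal subgroups $N_1\le N_2$ of $G$ contained in $\bar T(G)$, with projections $\pi_i\colon G\to G/N_i$, put $$A_G(N_1,N_2)=\ker\bigl(\inf\colon H^2(G/N_2)\to H^2(G/N_1)\bigr),$$ $$C_G(N_1,N_2)=\ker\bigl(\inf\colon H^2(G/N_2)_{\pi_2}\to H^2(G/N_1)_{\pi_1}\bigr),$$ and let $B_G(N_1,N_2)$ be the subgroup generated by the $\pi_2$-liftable pullbacks lying in $A_G(N_1,N_2)$. The transgression $\mathrm{trg}$ maps the group $\ker(\mathrm{res}\colon H^1(N_2)^G\to H^1(N_1))$ isomorphically onto $A_G(N_1,N_2)$, and the B-pairing $$\langle\cdot,\cdot\rangle^B_{N_1,N_2}\colon N_2/(N_2\cap\pi_1^{-1}[T(G/N_1)])\times B_G(N_1,N_2)\to\mathbb Z/p$$ is the well-defined bilinear map $\langle\bar\sigma,\mathrm{trg}(\psi)\rangle^B_{N_1,N_2}=\psi(\sigma)$.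 **Theorem.** Let $G$ be a profinite group and let $N_1\le N_2$ be closed normal subgroups of $G$ contained in $\bar T(G)$. The B-pairing induces a perfect bilinear map $$\langle\cdot,\cdot\rangle^C_{N_1,N_2}\colon N_2/(N_2\cap N_1T(G))\times C_G(N_1,N_2)\to\mathbb Z/p .$$ Precisely: $C_G(N_1,N_2)\le B_G(N_2\cap T(G),N_2)$ and $B_G(N_1,N_2)\le C_G(N_1,N_2)$, and there is a unique bilinear map $\langle\cdot,\cdot\rangle^C_{N_1,N_2}$ as above which satisfies $$\langle\bar\sigma,x\rangle^C_{N_1,N_2}=\langle\bar\sigma,x\rangle^B_{N_2\cap T(G),N_2}\quad(\sigma\in N_2,\ x\in C_G(N_1,N_2)),$$ $$\langle\bar\sigma,x\rangle^C_{N_1,N_2}=\langle\bar\sigma,x\rangle^B_{N_1,N_2}\quad(\sigma\in N_2,\ x\in B_G(N_1,N_2))$$ and is perfect: it is continuous in the first variable, and the induced maps $N_2/(N_2\cap N_1T(G))\to\mathrm{Hom}(C_G(N_1,N_2),\mathbb Z/p)$ and $C_G(N_1,N_2)\to\mathrm{Hom}_{\rm cont}(N_2/(N_2\cap N_1T(G)),\mathbb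 Z/p)$ are both bijective. -/

import Mathlib

noncomputable section

namespace CPairing

universe u v w

/-! ### Second continuous cohomology with trivial coefficients `ZMod m`

The group `H²(G) = H²(G, ℤ/m)` of a topological group `G` acting trivially on the discrete group
`ℤ/m`, computed by continuous inhomogeneous cochains. -/

section Cohomology

variable (m : ℕ) (G : Type*) [Group G] [TopologicalSpace G]

/-- Continuous inhomogeneous 2-cocycles `G × G → ℤ/m` (trivial action). -/
def cocycles : AddSubgroup C(G × G, ZMod m) where
  carrier := {c | ∀ a b d : G, c (b, d) - c (a * b, d) + c (a, b * d) - c (a, b) = 0}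
  zero_mem' := by intro a b d; simp
  add_mem' := by
    intro c c' hc hc' a b d
    have h := hc a b d
    have h' := hc' a b d
    simp only [ContinuousMap.add_apply]
    linear_combination h + h'
  neg_mem' := by
    intro c hc a b d
    have h := hc a b d
    simp only [ContinuousMap.neg_apply]
    linear_combination -h

/-- Continuous 2-coboundaries: the cocycles `(a, b) ↦ y b - y (a * b) + y a` with `y` a continuous
1-cochain. -/
def coboundaries : AddSubgroup (cocycles m G) where
  carrier := {c | ∃ y : C(G, ZMod m), ∀ a b : G, c.1 (a, b) = y b - y (a * b) + y a}
  zero_mem' := ⟨0, by intro a b; simp⟩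
  add_mem' := by
    rintro c c' ⟨y, hy⟩ ⟨y', hy'⟩
    refine ⟨y + y', fun a b => ?_⟩
    have h := hy a b
    have h' := hy' a b
    simp only [AddSubgroup.coe_add, ContinuousMap.add_apply]
    linear_combination h + h'
  neg_mem' := by
    rintro c ⟨y, hy⟩
    refine ⟨-y, fun a b => ?_⟩
    have h := hy a b
    simp only [AddSubgroup.coe_neg, ContinuousMap.neg_apply]
    linear_combination -h

/-- The second continuous (profinite) cohomology group `H²(G, ℤ/m)`. -/
abbrev H2 : Type _ := cocycles m G ⧸ coboundaries m G

variable {m G}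

/-- The cohomology class of a continuous 2-cocycle. -/
abbrev H2.mk (c : cocycles m G) : H2 m G := QuotientAddGroup.mk c

theorem H2.mk_eq_zero {c : cocycles m G} :
    H2.mk c = 0 ↔ ∃ y : C(G, ZMod m), ∀ a b : G, c.1 (a, b) = y b - y (a * b) + y a :=
  QuotientAddGroup.eq_zero_iff c

variable {K L : Type*} [Group K] [TopologicalSpace K] [Group L] [TopologicalSpace L]

/-- Pullback of cocycles along a continuous homomorphism. -/
def cocyclesMap (f : G →ₜ* K) : cocycles m K →+ cocycles m G where
  toFun c := ⟨⟨fun ab => c.1 (f ab.1, f ab.2), by fun_prop⟩, fun a b d => by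
    have h := c.2 (f a) (f b) (f d)
    simpa only [ContinuousMap.coe_mk, map_mul] using h⟩
  map_zero' := by ext; rfl
  map_add' c c' := by ext; rfl

theorem cocyclesMap_apply (f : G →ₜ* K) (c : cocycles m K) (a b : G) :
    (cocyclesMap f c).1 (a, b) = c.1 (f a, f b) := rfl

/-- The pullback `f^* : H²(K) → H²(G)` along a continuous homomorphism `f : G → K`. -/
def H2.map (f : G →ₜ* K) : H2 m K →+ H2 m G :=
  QuotientAddGroup.map _ _ (cocyclesMap f) (by
    rintro c ⟨y, hy⟩
    refine ⟨⟨fun g => y (f g), by fun_prop⟩, fun a b => ?_⟩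
    rw [cocyclesMap_apply, hy]
    simp only [ContinuousMap.coe_mk, map_mul])

theorem H2.map_mk (f : G →ₜ* K) (c : cocycles m K) :
    H2.map f (H2.mk c) = H2.mk (cocyclesMap f c) := rfl

theorem H2.map_map (f : G →ₜ* K) (g : K →ₜ* L) (x : H2 m L) :
    H2.map f (H2.map g x) = H2.map (g.comp f) x := by
  induction x using QuotientAddGroup.induction_on with
  | H c => rfl

end Cohomology

/-! ### Quotients, inflation -/

section Quotients

variable {m : ℕ} {G : Type*} [Group G] [TopologicalSpace G]

/-- The natural projection `G → G/N`. -/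
def proj (N : Subgroup G) [N.Normal] : G →ₜ* G ⧸ N where
  toMonoidHom := QuotientGroup.mk' N
  continuous_toFun := QuotientGroup.continuous_mk

/-- The natural projection `G/N₁ → G/N₂` for `N₁ ≤ N₂`. -/
def projQuot {N₁ N₂ : Subgroup G} [N₁.Normal] [N₂.Normal] (h : N₁ ≤ N₂) : G ⧸ N₁ →ₜ* G ⧸ N₂ where
  toMonoidHom := QuotientGroup.map N₁ N₂ (MonoidHom.id G) h
  continuous_toFun := by
    refine (QuotientGroup.isQuotientMap_mk N₁).continuous_iff.2 ?_
    exact QuotientGroup.continuous_mk (N := N₂)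

/-- The inflation `H²(G/N₂) → H²(G/N₁)` for `N₁ ≤ N₂`. -/
def inf {N₁ N₂ : Subgroup G} [N₁.Normal] [N₂.Normal] (h : N₁ ≤ N₂) :
    H2 m (G ⧸ N₂) →+ H2 m (G ⧸ N₁) :=
  H2.map (projQuot h)

variable (m) in
/-- `A_G(N₁, N₂)`, the kernel of the inflation `H²(G/N₂) → H²(G/N₁)`. -/
def groupA {N₁ N₂ : Subgroup G} [N₁.Normal] [N₂.Normal] (h : N₁ ≤ N₂) :
    AddSubgroup (H2 m (G ⧸ N₂)) :=
  (inf h).ker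

variable (m) in
/-- `H¹(N)^G`: the continuous homomorphisms `N → ℤ/m` that are invariant under conjugation
by `G`. -/
def H1inv (N : Subgroup G) [N.Normal] : AddSubgroup C(N, ZMod m) where
  carrier := {ψ | (∀ a b : N, ψ (a * b) = ψ a + ψ b) ∧
    ∀ (g : G) (n : N), ψ ⟨g * (n : G) * g⁻¹, Subgroup.Normal.conj_mem ‹_› (n : G) n.2 g⟩ = ψ n}
  zero_mem' := by simp
  add_mem' := by
    rintro ψ ψ' ⟨h1, h2⟩ ⟨h1', h2'⟩
    refine ⟨fun a b => ?_, fun g n => ?_⟩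
    · simp only [ContinuousMap.add_apply, h1, h1']; ring
    · simp only [ContinuousMap.add_apply, h2, h2']
  neg_mem' := by
    rintro ψ ⟨h1, h2⟩
    refine ⟨fun a b => ?_, fun g n => ?_⟩
    · simp only [ContinuousMap.neg_apply, h1]; ring
    · simp only [ContinuousMap.neg_apply, h2]

theorem mem_H1inv {N : Subgroup G} [N.Normal] {ψ : C(N, ZMod m)} :
    ψ ∈ H1inv m N ↔ (∀ a b : N, ψ (a * b) = ψ a + ψ b) ∧
      ∀ (g : G) (n : N),
        ψ ⟨g * (n : G) * g⁻¹, Subgroup.Normal.conj_mem ‹_› (n : G) n.2 g⟩ = ψ n :=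
  Iff.rfl

/-- The graph of the transgression `trg : H¹(N)^G → H²(G/N)`, in its usual explicit description:
`trg ψ = x` if `ψ` extends to a continuous 1-cochain `y : G → ℤ/m` whose coboundary is the
inflation of a continuous 2-cocycle of `G/N` with class `x`. -/
def IsTransgression {N : Subgroup G} [N.Normal] (ψ : H1inv m N) (x : H2 m (G ⧸ N)) : Prop :=
  ∃ (y : C(G, ZMod m)) (c : cocycles m (G ⧸ N)),
    (∀ n : N, y n = ψ.1 n) ∧
    (∀ a b : G, c.1 ((a : G ⧸ N), (b : G ⧸ N)) = y b - y (a * b) + y a) ∧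
    H2.mk c = x

end Quotients

/-! ### Central extensions and the subgroups `T`, `T̄` -/

/-- A central extension of profinite groups `0 → ℤ/m → U → Ū → 1`. -/
structure CentralExtension (m : ℕ) where
  /-- The middle group. -/
  U : ProfiniteGrp.{v}
  /-- The quotient group. -/
  Ubar : ProfiniteGrp.{v}
  /-- The inclusion of the kernel. -/
  incl : Multiplicative (ZMod m) →* U
  /-- The projection `λ`. -/
  lam : U →ₜ* Ubar
  incl_injective : Function.Injective incl
  lam_surjective : Function.Surjective lam
  exact : incl.range = lam.toMonoidHom.ker
  central : incl.range ≤ Subgroup.center U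

/-- A nonempty family `Ω` of central extensions of profinite groups by `ℤ/m` such that, for every
member, (I) finitely many continuous homomorphisms `Ū → U` have trivial common kernel, and
(II) `ℤ/m` embeds in `Ū`. -/
structure ExtensionFamily (m : ℕ) (ι : Type w) where
  /-- The members of the family. -/
  ext : ι → CentralExtension.{v} m
  nonempty : Nonempty ι
  separating : ∀ i, ∃ (n : ℕ) (γ : Fin n → ((ext i).Ubar →ₜ* (ext i).U)),
    ⨅ k, (γ k).toMonoidHom.ker = ⊥
  embeds : ∀ i, ∃ j : Multiplicative (ZMod m) →* (ext i).Ubar, Function.Injective j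

/-- `T^U(G)`: the intersection of the kernels of all continuous homomorphisms `G → U`. -/
def homKernel (U G : Type*) [Group U] [TopologicalSpace U] [Group G] [TopologicalSpace G] :
    Subgroup G :=
  ⨅ ρ : G →ₜ* U, ρ.toMonoidHom.ker

section TSubgroups

variable {m : ℕ} {ι : Type w} (Ω : ExtensionFamily.{v} m ι)
  (G : Type*) [Group G] [TopologicalSpace G]

/-- `T(G)`, the intersection of all kernels of continuous homomorphisms `G → U_ω`. -/
def T : Subgroup G := ⨅ i, homKernel (Ω.ext i).U G

/-- `T̄(G)`, the intersection of all kernels of continuous homomorphisms `G → Ū_ω`. -/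
def Tbar : Subgroup G := ⨅ i, homKernel (Ω.ext i).Ubar G

variable {Ω G}

theorem mem_T {g : G} : g ∈ T Ω G ↔ ∀ (i : ι) (ρ : G →ₜ* (Ω.ext i).U), ρ g = 1 := by
  simp only [T, homKernel, Subgroup.mem_iInf, MonoidHom.mem_ker]
  rfl

theorem mem_Tbar {g : G} : g ∈ Tbar Ω G ↔ ∀ (i : ι) (ρ : G →ₜ* (Ω.ext i).Ubar), ρ g = 1 := by
  simp only [Tbar, homKernel, Subgroup.mem_iInf, MonoidHom.mem_ker]
  rfl

instance T_normal : (T Ω G).Normal :=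
  ⟨fun n hn g => by
    rw [mem_T] at hn ⊢
    intro i ρ
    simp [hn i ρ]⟩

end TSubgroups

/-! ### The classifying element of a central extension -/

section Classifying

variable {m : ℕ} [NeZero m]

theorem CentralExtension.exists_section (ω : CentralExtension.{v} m) :
    ∃ s : C(ω.Ubar, ω.U), ∀ x, ω.lam (s x) = x := by
  classical
  have hfin : ((ω.incl.range : Set ω.U) \ {1}).Finite := by
    refine Set.Finite.subset ?_ Set.sdiff_subset
    rw [MonoidHom.coe_range]
    have : Finite (Multiplicative (ZMod m)) := inferInstanceAs (Finite (ZMod m))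
    exact Set.finite_range _
  obtain ⟨V, hV⟩ := ProfiniteGrp.exist_openNormalSubgroup_sub_open_nhds_of_one
    (G := ω.U) (U := ((ω.incl.range : Set ω.U) \ {1})ᶜ) hfin.isClosed.isOpen_compl (by simp)
  have hV1 : ∀ v : ω.U, v ∈ V.toSubgroup → ω.lam v = 1 → v = 1 := by
    intro v hv h1
    by_contra hne
    have : v ∈ ω.incl.range := by rw [ω.exact]; exact h1
    exact hV hv ⟨this, hne⟩
  let W : Subgroup ω.Ubar := V.toSubgroup.map ω.lam.toMonoidHom
  let q : ω.Ubar → ω.Ubar ⧸ W := fun x => (x : ω.Ubar ⧸ W)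
  have hu : ∀ k : ω.Ubar ⧸ W, ∃ g : ω.U, q (ω.lam g) = k := by
    intro k
    obtain ⟨x, rfl⟩ := QuotientGroup.mk_surjective k
    obtain ⟨g, rfl⟩ := ω.lam_surjective x
    exact ⟨g, rfl⟩
  choose r hr using hu
  let S : Set ω.U := {g | (r (q (ω.lam g)))⁻¹ * g ∈ V.toSubgroup}
  have hqV : ∀ g v : ω.U, v ∈ V.toSubgroup → q (ω.lam (g * v)) = q (ω.lam g) := by
    intro g v hv
    refine (QuotientGroup.eq.2 ?_).symm
    rw [map_mul, inv_mul_cancel_left]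
    exact ⟨v, hv, rfl⟩
  have hSV : ∀ g v : ω.U, v ∈ V.toSubgroup → (g * v ∈ S ↔ g ∈ S) := by
    intro g v hv
    simp only [S, Set.mem_ofPred_eq, hqV g v hv, ← mul_assoc]
    exact Subgroup.mul_mem_cancel_right _ hv
  have hVo : IsOpen (V.toSubgroup : Set ω.U) := V.isOpen
  have hSc : IsClosed S := by
    rw [← isOpen_compl_iff, isOpen_iff_mem_nhds]
    intro g hg
    have hop : IsOpen ((fun x => g⁻¹ * x) ⁻¹' (V.toSubgroup : Set ω.U)) :=
      hVo.preimage (by fun_prop)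
    refine Filter.mem_of_superset (hop.mem_nhds (by simp)) ?_
    intro x hx hxS
    apply hg
    have := (hSV g (g⁻¹ * x) hx).1
    rw [mul_inv_cancel_left] at this
    exact this hxS
  have : CompactSpace S := isCompact_iff_compactSpace.1 hSc.isCompact
  let f : S → ω.Ubar := fun g => ω.lam g.1
  have hfc : Continuous f := by fun_prop
  have hfb : Function.Bijective f := by
    constructor
    · rintro ⟨a, ha⟩ ⟨b, hb⟩ hab
      have hab' : ω.lam a = ω.lam b := hab
      have h : a⁻¹ * b ∈ V.toSubgroup := by
        have ha' : (r (q (ω.lam a)))⁻¹ * a ∈ V.toSubgroup := ha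
        have hb' : (r (q (ω.lam b)))⁻¹ * b ∈ V.toSubgroup := hb
        rw [← hab'] at hb'
        have := V.toSubgroup.mul_mem (V.toSubgroup.inv_mem ha') hb'
        simpa [mul_assoc] using this
      have := hV1 _ h (by rw [map_mul, map_inv, hab', inv_mul_cancel])
      exact Subtype.ext (inv_mul_eq_one.1 this)
    · intro x
      have h := hr (q x)
      obtain ⟨v, hv, hvx⟩ := QuotientGroup.eq.1 h
      have hx : ω.lam (r (q x) * v) = x := by
        rw [map_mul]
        have : ω.lam v = (ω.lam (r (q x)))⁻¹ * x := hvx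
        rw [this, mul_inv_cancel_left]
      refine ⟨⟨r (q x) * v, ?_⟩, hx⟩
      change (r (q (ω.lam (r (q x) * v))))⁻¹ * (r (q x) * v) ∈ V.toSubgroup
      rw [hx, inv_mul_cancel_left]
      exact hv
  let e := hfc.homeoOfEquivCompactToT2 (f := Equiv.ofBijective f hfb)
  refine ⟨⟨fun x => (e.symm x).1, by fun_prop⟩, fun x => ?_⟩
  exact e.apply_symm_apply x

/-- A continuous set-theoretic section of `λ`. -/
def CentralExtension.sec (ω : CentralExtension.{v} m) : C(ω.Ubar, ω.U) :=
  ω.exists_section.choose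

theorem CentralExtension.lam_sec (ω : CentralExtension.{v} m) (x : ω.Ubar) :
    ω.lam (ω.sec x) = x :=
  ω.exists_section.choose_spec x

theorem CentralExtension.isEmbedding_incl (ω : CentralExtension.{v} m) :
    Topology.IsEmbedding (fun z : ZMod m => ω.incl (Multiplicative.ofAdd z)) :=
  (Continuous.isClosedEmbedding continuous_of_discreteTopology
    (ω.incl_injective.comp Multiplicative.ofAdd.injective)).isEmbedding

theorem CentralExtension.exists_factor (ω : CentralExtension.{v} m) :
    ∃ c : C(ω.Ubar × ω.Ubar, ZMod m), ∀ a b,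
      ω.sec a * ω.sec b = ω.incl (Multiplicative.ofAdd (c (a, b))) * ω.sec (a * b) := by
  have h : ∀ ab : ω.Ubar × ω.Ubar, ∃ z : ZMod m, ω.incl (Multiplicative.ofAdd z) =
      ω.sec ab.1 * ω.sec ab.2 * (ω.sec (ab.1 * ab.2))⁻¹ := by
    intro ab
    have : ω.sec ab.1 * ω.sec ab.2 * (ω.sec (ab.1 * ab.2))⁻¹ ∈ ω.incl.range := by
      rw [ω.exact]
      change ω.lam _ = 1
      simp [ω.lam_sec]
    obtain ⟨z, hz⟩ := this
    exact ⟨z.toAdd, hz⟩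
  choose c hc using h
  refine ⟨⟨c, ?_⟩, fun a b => ?_⟩
  · rw [ω.isEmbedding_incl.continuous_iff]
    have : (fun z : ZMod m => ω.incl (Multiplicative.ofAdd z)) ∘ c =
        fun ab => ω.sec ab.1 * ω.sec ab.2 * (ω.sec (ab.1 * ab.2))⁻¹ := funext hc
    rw [this]
    fun_prop
  · simp only [ContinuousMap.coe_mk, hc, inv_mul_cancel_right]

/-- The factor set of the section: `s(a) s(b) = c(a, b) s(ab)`. -/
def CentralExtension.factor (ω : CentralExtension.{v} m) : C(ω.Ubar × ω.Ubar, ZMod m) :=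
  ω.exists_factor.choose

theorem CentralExtension.factor_spec (ω : CentralExtension.{v} m) (a b : ω.Ubar) :
    ω.sec a * ω.sec b = ω.incl (Multiplicative.ofAdd (ω.factor (a, b))) * ω.sec (a * b) :=
  ω.exists_factor.choose_spec a b

theorem CentralExtension.incl_comm (ω : CentralExtension.{v} m) (z : Multiplicative (ZMod m))
    (g : ω.U) : g * ω.incl z = ω.incl z * g :=
  Subgroup.mem_center_iff.1 (ω.central ⟨z, rfl⟩) g

/-- The factor set as a 2-cocycle. -/
def CentralExtension.cocycle (ω : CentralExtension.{v} m) : cocycles m ω.Ubar :=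
  ⟨ω.factor, fun a b d => by
    have h1 : ω.sec a * ω.sec b * ω.sec d = ω.incl (Multiplicative.ofAdd
        (ω.factor (a, b) + ω.factor (a * b, d))) * ω.sec (a * b * d) := by
      rw [ω.factor_spec a b, mul_assoc, ω.factor_spec (a * b) d, ofAdd_add, map_mul ω.incl,
        mul_assoc (ω.incl _) (ω.incl _)]
    have h2 : ω.sec a * (ω.sec b * ω.sec d) = ω.incl (Multiplicative.ofAdd
        (ω.factor (b, d) + ω.factor (a, b * d))) * ω.sec (a * (b * d)) := by
      rw [ω.factor_spec b d, ← mul_assoc, ω.incl_comm, mul_assoc, ω.factor_spec a (b * d),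
        ofAdd_add, map_mul ω.incl, mul_assoc]
    rw [mul_assoc, h2, mul_assoc, mul_left_inj] at h1
    have h3 := Multiplicative.ofAdd.injective (ω.incl_injective h1)
    linear_combination h3⟩

/-- The classifying element `α_ω ∈ H²(Ū)` of the extension, i.e. the class of the factor set of
a continuous section. -/
def CentralExtension.alpha (ω : CentralExtension.{v} m) : H2 m ω.Ubar :=
  H2.mk ω.cocycle

/-- The classifying element may be computed from any continuous section. -/
theorem CentralExtension.alpha_eq (ω : CentralExtension.{v} m) (s : C(ω.Ubar, ω.U))
    (hs : ∀ x, ω.lam (s x) = x) (c : cocycles m ω.Ubar)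
    (hc : ∀ a b, s a * s b = ω.incl (Multiplicative.ofAdd (c.1 (a, b))) * s (a * b)) :
    ω.alpha = H2.mk c := by
  have h : ∀ a, ∃ z : ZMod m, ω.incl (Multiplicative.ofAdd z) = ω.sec a * (s a)⁻¹ := by
    intro a
    have : ω.sec a * (s a)⁻¹ ∈ ω.incl.range := by
      rw [ω.exact]
      change ω.lam _ = 1
      simp [ω.lam_sec, hs]
    obtain ⟨z, hz⟩ := this
    exact ⟨z.toAdd, hz⟩
  choose z hz using h
  have hzc : Continuous z := by
    rw [ω.isEmbedding_incl.continuous_iff]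
    have : (fun z : ZMod m => ω.incl (Multiplicative.ofAdd z)) ∘ z =
        fun a => ω.sec a * (s a)⁻¹ := funext hz
    rw [this]
    fun_prop
  have hz' : ∀ a, ω.sec a = ω.incl (Multiplicative.ofAdd (z a)) * s a := by
    intro a; rw [hz, inv_mul_cancel_right]
  rw [CentralExtension.alpha, ← sub_eq_zero]
  refine (H2.mk_eq_zero (c := ω.cocycle - c)).2 ⟨⟨z, hzc⟩, fun a b => ?_⟩
  have h1 := ω.factor_spec a b
  rw [hz' a, hz' b, hz' (a * b), mul_assoc, ← mul_assoc (s a), ω.incl_comm, mul_assoc, hc,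
    ← mul_assoc, ← mul_assoc, ← mul_assoc, mul_left_inj, ← map_mul ω.incl, ← map_mul ω.incl,
    ← map_mul ω.incl, ← ofAdd_add, ← ofAdd_add, ← ofAdd_add] at h1
  have h2 := Multiplicative.ofAdd.injective (ω.incl_injective h1)
  change ω.factor (a, b) - c.1 (a, b) = z b - z (a * b) + z a
  linear_combination -h2

end Classifying

/-! ### Liftable pullbacks and the groups `B_G(N₁, N₂)`, `C_G(N₁, N₂)` -/

section Liftable

variable {m : ℕ} [NeZero m] {ι : Type w} (Ω : ExtensionFamily.{v} m ι)
  {G : Type u} [Group G] [TopologicalSpace G]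

/-- `ρ̄ : G/N → Ū` is `π`-liftable, with `π : G → G/N` the projection, if there is a continuous
homomorphism `ρ : G → U` with `λ ∘ ρ = ρ̄ ∘ π`. -/
def IsLiftable (ω : CentralExtension.{v} m) (N : Subgroup G) [N.Normal]
    (ρbar : G ⧸ N →ₜ* ω.Ubar) : Prop :=
  ∃ ρ : G →ₜ* ω.U, ∀ g : G, ω.lam (ρ g) = ρbar (g : G ⧸ N)

/-- The set of `π`-liftable pullbacks `ρ̄^*(α_ω)` in `H²(G/N)`. -/
def liftablePullbacks (N : Subgroup G) [N.Normal] : Set (H2 m (G ⧸ N)) :=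
  {x | ∃ (i : ι) (ρbar : G ⧸ N →ₜ* (Ω.ext i).Ubar),
    IsLiftable (Ω.ext i) N ρbar ∧ x = H2.map ρbar (Ω.ext i).alpha}

/-- `H²(G/N)_π`, the `π`-liftable part of `H²(G/N)`. -/
def liftablePart (N : Subgroup G) [N.Normal] : AddSubgroup (H2 m (G ⧸ N)) :=
  AddSubgroup.closure (liftablePullbacks Ω N)

/-- `B_G(N₁, N₂)`, generated by the liftable pullbacks in `H²(G/N₂)` whose inflation to
`H²(G/N₁)` vanishes. -/
def groupB {N₁ N₂ : Subgroup G} [N₁.Normal] [N₂.Normal] (h : N₁ ≤ N₂) :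
    AddSubgroup (H2 m (G ⧸ N₂)) :=
  AddSubgroup.closure (liftablePullbacks Ω N₂ ∩ groupA m h)

theorem inf_mem_liftablePart {N₁ N₂ : Subgroup G} [N₁.Normal] [N₂.Normal] (h : N₁ ≤ N₂)
    {x : H2 m (G ⧸ N₂)} (hx : x ∈ liftablePart Ω N₂) : inf h x ∈ liftablePart Ω N₁ := by
  refine (AddSubgroup.closure_le (K := (liftablePart Ω N₁).comap (inf h))).2 ?_ hx
  rintro _ ⟨i, ρbar, ⟨ρ, hρ⟩, rfl⟩
  exact AddSubgroup.subset_closure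
    ⟨i, ρbar.comp (projQuot h), ⟨ρ, fun g => hρ g⟩, H2.map_map _ _ _⟩

/-- The inflation `H²(G/N₂)_{π₂} → H²(G/N₁)_{π₁}` between liftable parts. -/
def infLiftable {N₁ N₂ : Subgroup G} [N₁.Normal] [N₂.Normal] (h : N₁ ≤ N₂) :
    liftablePart Ω N₂ →+ liftablePart Ω N₁ :=
  ((inf h).comp (liftablePart Ω N₂).subtype).codRestrict _
    fun x => inf_mem_liftablePart Ω h x.2

/-- `C_G(N₁, N₂)`, the kernel of the inflation `H²(G/N₂)_{π₂} → H²(G/N₁)_{π₁}`. -/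
def groupC {N₁ N₂ : Subgroup G} [N₁.Normal] [N₂.Normal] (h : N₁ ≤ N₂) :
    AddSubgroup (liftablePart Ω N₂) :=
  (infLiftable Ω h).ker

theorem groupB_le_groupA {N₁ N₂ : Subgroup G} [N₁.Normal] [N₂.Normal] (h : N₁ ≤ N₂) :
    groupB Ω h ≤ groupA m h :=
  (AddSubgroup.closure_le _).2 Set.inter_subset_right

end Liftable

/-! ### The pairings -/

section Pairings

/-- A bilinear map `A × B → ℤ/m`, with `A` written multiplicatively and `B` additively, given as
the induced homomorphism `A → Hom(B, ℤ/m)`. -/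
abbrev Pairing (m : ℕ) (A B : Type*) [Group A] [AddCommGroup B] : Type _ :=
  A →* Multiplicative (B →+ ZMod m)

/-- The value of a bilinear map. -/
def Pairing.val {m : ℕ} {A B : Type*} [Group A] [AddCommGroup B] (β : Pairing m A B)
    (a : A) (b : B) : ZMod m :=
  (β a).toAdd b

/-- A bilinear map `A × B → ℤ/m`, with `A` a topological group and `B` a discrete group, is
perfect if it is continuous in `A` and both induced maps `A → Hom(B, ℤ/m)` and
`B → Hom_cont(A, ℤ/m)` are bijective. -/
structure Pairing.IsPerfect {m : ℕ} {A B : Type*} [Group A] [TopologicalSpace A] [AddCommGroup B]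
    (β : Pairing m A B) : Prop where
  continuous_left : ∀ b, Continuous fun a => β.val a b
  injective_left : ∀ a a', (∀ b, β.val a b = β.val a' b) → a = a'
  surjective_left : ∀ f : B →+ ZMod m, ∃ a, ∀ b, β.val a b = f b
  injective_right : ∀ b b', (∀ a, β.val a b = β.val a b') → b = b'
  surjective_right : ∀ χ : A →ₜ* Multiplicative (ZMod m), ∃ b, ∀ a, β.val a b = (χ a).toAdd

variable {m : ℕ} [NeZero m] {ι : Type w} (Ω : ExtensionFamily.{v} m ι)
  {G : Type u} [Group G] [TopologicalSpace G]

/-- Every continuous homomorphism `G → ℤ/m` is trivial on `T̄(G)`. -/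
theorem eq_zero_of_mem_Tbar (f : C(G, ZMod m)) (hf : ∀ a b, f (a * b) = f a + f b) {g : G}
    (hg : g ∈ Tbar Ω G) : f g = 0 := by
  obtain ⟨i⟩ := Ω.nonempty
  obtain ⟨j, hj⟩ := Ω.embeds i
  have h1 : f 1 = 0 := by simpa using hf 1 1
  let ρ : G →ₜ* (Ω.ext i).Ubar :=
    { toFun := fun a => j (Multiplicative.ofAdd (f a))
      map_one' := by simp [h1]
      map_mul' := fun a b => by rw [hf, ofAdd_add, map_mul]
      continuous_toFun :=
        (continuous_of_discreteTopology (f := fun z : ZMod m => j (Multiplicative.ofAdd z))).comp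
          f.continuous }
  have h := mem_Tbar.1 hg i ρ
  have h' : j (Multiplicative.ofAdd (f g)) = j 1 := by rw [map_one]; exact h
  exact Multiplicative.ofAdd.injective (hj h')

theorem isTransgression_add {N : Subgroup G} [N.Normal] {ψ ψ' : H1inv m N} {x x' : H2 m (G ⧸ N)}
    (h : IsTransgression ψ x) (h' : IsTransgression ψ' x') : IsTransgression (ψ + ψ') (x + x') := by
  obtain ⟨y, c, h1, h2, rfl⟩ := h
  obtain ⟨y', c', h1', h2', rfl⟩ := h'
  refine ⟨y + y', c + c', fun n => ?_, fun a b => ?_, rfl⟩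
  · simp [h1, h1']
  · have e := h2 a b
    have e' := h2' a b
    simp only [AddSubgroup.coe_add, ContinuousMap.add_apply]
    linear_combination e + e'

theorem coe_eq_one_of_mem {N : Subgroup G} [N.Normal] {g : G} (hg : g ∈ N) : (g : G ⧸ N) = 1 :=
  (QuotientGroup.eq_one_iff g).2 hg

/-- If the inflation to `G/N₁` of a cocycle of `G/N₂` is the coboundary of `z`, then any
transgression preimage of its class is given on `N₂` by `z` up to a constant. -/
theorem transgression_formula {N₁ N₂ : Subgroup G} [N₁.Normal] [N₂.Normal] (h : N₁ ≤ N₂)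
    (hN : N₂ ≤ Tbar Ω G) (c : cocycles m (G ⧸ N₂)) (z : C(G ⧸ N₁, ZMod m))
    (hz : ∀ a b, (cocyclesMap (projQuot h) c).1 (a, b) = z b - z (a * b) + z a)
    (ψ : H1inv m N₂) (hψ : IsTransgression ψ (H2.mk c)) (n : N₂) :
    ψ.1 n = z ((n : G) : G ⧸ N₁) - z 1 := by
  obtain ⟨y, c', hy, hc', hcc⟩ := hψ
  have hw : H2.mk (c' - c) = 0 := sub_eq_zero.2 hcc
  obtain ⟨w, hw⟩ := H2.mk_eq_zero.1 hw
  let f : C(G, ZMod m) := ⟨fun g => y g - z (g : G ⧸ N₁) - w (g : G ⧸ N₂), by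
    have e1 : Continuous fun g : G => (g : G ⧸ N₁) := QuotientGroup.continuous_mk
    have e2 : Continuous fun g : G => (g : G ⧸ N₂) := QuotientGroup.continuous_mk
    fun_prop⟩
  have hf : ∀ a b, f (a * b) = f a + f b := by
    intro a b
    have e1 := hc' a b
    have e2 : c.1 ((a : G ⧸ N₂), (b : G ⧸ N₂)) =
      z (b : G ⧸ N₁) - z ((a * b : G) : G ⧸ N₁) + z (a : G ⧸ N₁) := hz a b
    have e3 : c'.1 ((a : G ⧸ N₂), (b : G ⧸ N₂)) - c.1 ((a : G ⧸ N₂), (b : G ⧸ N₂)) =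
      w (b : G ⧸ N₂) - w ((a * b : G) : G ⧸ N₂) + w (a : G ⧸ N₂) := hw a b
    simp only [f, ContinuousMap.coe_mk]
    linear_combination e1 - e2 - e3
  have hn : f n = 0 := eq_zero_of_mem_Tbar Ω f hf (hN n.2)
  have h1 : f 1 = 0 := by simpa using hf 1 1
  have hψ1 : y 1 = 0 := by
    have := hy 1
    have e := (mem_H1inv.1 ψ.2).1 1 1
    simp only [mul_one, left_eq_add] at e
    simpa [e] using this
  simp only [f, ContinuousMap.coe_mk, coe_eq_one_of_mem n.2, QuotientGroup.mk_one] at hn h1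
  rw [← hy n]
  linear_combination hn - h1 + hψ1

/-- For `N₁ ≤ N₂ ≤ T̄(G)`, the transgression is a bijection from the kernel of the restriction
`H¹(N₂)^G → H¹(N₁)` onto `A_G(N₁, N₂)` (existence and uniqueness of preimages). -/
theorem existsUnique_transgression {N₁ N₂ : Subgroup G} [N₁.Normal] [N₂.Normal] (h : N₁ ≤ N₂)
    (hN : N₂ ≤ Tbar Ω G) (x : groupA m h) :
    ∃! ψ : H1inv m N₂, (∀ n : N₂, (n : G) ∈ N₁ → ψ.1 n = 0) ∧ IsTransgression ψ x.1 := by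
  obtain ⟨x, hx⟩ := x
  induction x using QuotientAddGroup.induction_on with
  | H c =>
  obtain ⟨z, hz⟩ := H2.mk_eq_zero.1 (show H2.mk (cocyclesMap (projQuot h) c) = 0 from hx)
  have hz' : ∀ a b : G, c.1 ((a : G ⧸ N₂), (b : G ⧸ N₂)) =
      z (b : G ⧸ N₁) - z ((a * b : G) : G ⧸ N₁) + z (a : G ⧸ N₁) := fun a b => hz a b
  have hc1 : ∀ a : G ⧸ N₂, c.1 (1, a) = z 1 := by
    intro a
    have e := c.2 1 1 a
    have e' := hz' 1 1
    simp only [one_mul, mul_one, QuotientGroup.mk_one] at e e'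
    linear_combination e + e'
  have hc2 : ∀ a : G ⧸ N₂, c.1 (a, 1) = z 1 := by
    intro a
    have e := c.2 a 1 1
    have e' := hz' 1 1
    simp only [one_mul, mul_one, QuotientGroup.mk_one] at e e'
    linear_combination -e + e'
  have hl : ∀ (n : G) (a : G), n ∈ N₂ →
      z ((n * a : G) : G ⧸ N₁) = z (n : G ⧸ N₁) + z (a : G ⧸ N₁) - z 1 := by
    intro n a hn
    have e := hz' n a
    rw [coe_eq_one_of_mem hn, hc1] at e
    linear_combination e
  have hr : ∀ (n : G) (a : G), n ∈ N₂ →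
      z ((a * n : G) : G ⧸ N₁) = z (a : G ⧸ N₁) + z (n : G ⧸ N₁) - z 1 := by
    intro n a hn
    have e := hz' a n
    rw [coe_eq_one_of_mem hn, hc2] at e
    linear_combination e
  have ctn : Continuous fun g : G => (g : G ⧸ N₁) := QuotientGroup.continuous_mk
  let ψ : H1inv m N₂ := ⟨⟨fun n => z ((n : G) : G ⧸ N₁) - z 1, by fun_prop⟩, by
    refine mem_H1inv.2 ⟨fun a b => ?_, fun g n => ?_⟩
    · simp only [ContinuousMap.coe_mk, Subgroup.coe_mul, hl _ _ a.2]
      ring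
    · have hm : g * (n : G) * g⁻¹ ∈ N₂ := Subgroup.Normal.conj_mem ‹_› (n : G) n.2 g
      have e1 := hl (g * n * g⁻¹) g hm
      have e2 := hr n g n.2
      rw [inv_mul_cancel_right] at e1
      simp only [ContinuousMap.coe_mk]
      linear_combination e2 - e1⟩
  refine ⟨ψ, ⟨fun n hn => ?_, ?_⟩, ?_⟩
  · simp [ψ, coe_eq_one_of_mem hn]
  · let k : C(G ⧸ N₂, ZMod m) := ContinuousMap.const _ (z 1)
    refine ⟨⟨fun g => z (g : G ⧸ N₁) - z 1, by fun_prop⟩,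
      ⟨⟨fun ab => c.1 ab - z 1, by fun_prop⟩, fun a b d => ?_⟩, fun n => rfl, fun a b => ?_, ?_⟩
    · have e := c.2 a b d
      simp only [ContinuousMap.coe_mk]
      linear_combination e
    · have e := hz' a b
      simp only [ContinuousMap.coe_mk]
      linear_combination e
    · rw [← sub_eq_zero]
      refine H2.mk_eq_zero.2 ⟨-k, fun a b => ?_⟩
      simp [k]
  · rintro ψ' ⟨-, hψ'⟩
    refine Subtype.ext (ContinuousMap.ext fun n => ?_)
    exact transgression_formula Ω h hN c z hz ψ' hψ' n

/-- The transgression preimage in `Ker (H¹(N₂)^G → H¹(N₁))` of an element of `A_G(N₁, N₂)`. -/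
def trgInv {N₁ N₂ : Subgroup G} [N₁.Normal] [N₂.Normal] (h : N₁ ≤ N₂) (hN : N₂ ≤ Tbar Ω G)
    (x : groupA m h) : H1inv m N₂ :=
  (existsUnique_transgression Ω h hN x).choose

theorem trgInv_spec {N₁ N₂ : Subgroup G} [N₁.Normal] [N₂.Normal] (h : N₁ ≤ N₂)
    (hN : N₂ ≤ Tbar Ω G) (x : groupA m h) :
    (∀ n : N₂, (n : G) ∈ N₁ → (trgInv Ω h hN x).1 n = 0) ∧
      IsTransgression (trgInv Ω h hN x) x.1 :=
  (existsUnique_transgression Ω h hN x).choose_spec.1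

theorem trgInv_add {N₁ N₂ : Subgroup G} [N₁.Normal] [N₂.Normal] (h : N₁ ≤ N₂)
    (hN : N₂ ≤ Tbar Ω G) (x x' : groupA m h) :
    trgInv Ω h hN (x + x') = trgInv Ω h hN x + trgInv Ω h hN x' := by
  obtain ⟨h1, h2⟩ := trgInv_spec Ω h hN x
  obtain ⟨h1', h2'⟩ := trgInv_spec Ω h hN x'
  refine (existsUnique_transgression Ω h hN (x + x')).unique (trgInv_spec Ω h hN _)
    ⟨fun n hn => ?_, isTransgression_add h2 h2'⟩
  simp [h1 n hn, h1' n hn]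

/-- The pairing `⟨·,·⟩^A` on `N₂ × A_G(N₁, N₂)`: `⟨σ, trg ψ⟩ = ψ(σ)` for `ψ ∈ H¹(N₂)^G` with
trivial restriction to `N₁`. -/
def pairingA {N₁ N₂ : Subgroup G} [N₁.Normal] [N₂.Normal] (h : N₁ ≤ N₂) (hN : N₂ ≤ Tbar Ω G) :
    Pairing m N₂ (groupA m h) :=
  MonoidHom.mk' (fun σ => Multiplicative.ofAdd (AddMonoidHom.mk'
      (fun x => (trgInv Ω h hN x).1 σ) fun x x' => by rw [trgInv_add]; rfl))
    fun σ τ => by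
      refine Multiplicative.toAdd.injective (AddMonoidHom.ext fun x => ?_)
      exact (mem_H1inv.1 (trgInv Ω h hN x).2).1 σ τ

/-- `N₂ ∩ π₁⁻¹[T(G/N₁)]`, as a subgroup of `N₂`. -/
def leftKernelB (N₁ N₂ : Subgroup G) [N₁.Normal] : Subgroup N₂ :=
  ((T Ω (G ⧸ N₁)).comap (QuotientGroup.mk' N₁)).subgroupOf N₂

instance leftKernelB_normal (N₁ N₂ : Subgroup G) [N₁.Normal] : (leftKernelB Ω N₁ N₂).Normal :=
  inferInstanceAs (((T Ω (G ⧸ N₁)).comap (QuotientGroup.mk' N₁)).subgroupOf N₂).Normal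

theorem trgInv_pullback_eq_zero {N₁ N₂ : Subgroup G} [N₁.Normal] [N₂.Normal] (h : N₁ ≤ N₂)
    (hN : N₂ ≤ Tbar Ω G) (ω : CentralExtension.{v} m) (ρbar : G ⧸ N₂ →ₜ* ω.Ubar)
    (hA : H2.map ρbar ω.alpha ∈ groupA m h) (σ : N₂)
    (hσ : ∀ ρ : G ⧸ N₁ →ₜ* ω.U, ρ ((σ : G) : G ⧸ N₁) = 1) :
    (trgInv Ω h hN ⟨_, hA⟩).1 σ = 0 := by
  obtain ⟨z, hz⟩ := H2.mk_eq_zero.1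
    (show H2.mk (cocyclesMap (projQuot h) (cocyclesMap ρbar ω.cocycle)) = 0 from hA)
  rw [transgression_formula Ω h hN (cocyclesMap ρbar ω.cocycle) z hz _
    (trgInv_spec Ω h hN ⟨_, hA⟩).2 σ]
  let r : G ⧸ N₁ →ₜ* ω.Ubar := ρbar.comp (projQuot h)
  have hz' : ∀ a b, ω.factor (r a, r b) = z b - z (a * b) + z a := hz
  let F : G ⧸ N₁ → ω.U := fun g => ω.incl (Multiplicative.ofAdd (-z g)) * ω.sec (r g)
  have hFm : ∀ a b, F (a * b) = F a * F b := by
    intro a b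
    have e := ω.factor_spec (r a) (r b)
    change _ = ω.incl (Multiplicative.ofAdd (-z a)) * ω.sec (r a) *
      (ω.incl (Multiplicative.ofAdd (-z b)) * ω.sec (r b))
    rw [mul_assoc, ← mul_assoc (ω.sec (r a)), ω.incl_comm, mul_assoc, e, ← mul_assoc,
      ← mul_assoc, ← map_mul, ← map_mul, ← ofAdd_add, ← ofAdd_add, hz' a b, ← map_mul r]
    change ω.incl (Multiplicative.ofAdd (-z (a * b))) * ω.sec (r (a * b)) = _
    congr 3
    ring
  have hFc : Continuous F := by
    have e : Continuous fun g : G ⧸ N₁ => ω.incl (Multiplicative.ofAdd (-z g)) :=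
      ω.isEmbedding_incl.continuous.comp (by fun_prop : Continuous fun g : G ⧸ N₁ => -z g)
    exact e.mul (by fun_prop)
  let ρ : G ⧸ N₁ →ₜ* ω.U := { MonoidHom.mk' F hFm with continuous_toFun := hFc }
  have hσ1 : F ((σ : G) : G ⧸ N₁) = 1 := hσ ρ
  have h1 : F 1 = 1 := by simpa using hFm 1 1
  have hr1 : r ((σ : G) : G ⧸ N₁) = r 1 := by
    change ρbar ((σ : G) : G ⧸ N₂) = ρbar ((1 : G) : G ⧸ N₂)
    rw [coe_eq_one_of_mem σ.2, QuotientGroup.mk_one]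
  have e : F ((σ : G) : G ⧸ N₁) = F 1 := hσ1.trans h1.symm
  simp only [F, hr1, mul_left_inj] at e
  have e' := Multiplicative.ofAdd.injective (ω.incl_injective e)
  linear_combination -e'

theorem pairingA_eq_zero {N₁ N₂ : Subgroup G} [N₁.Normal] [N₂.Normal] (h : N₁ ≤ N₂)
    (hN : N₂ ≤ Tbar Ω G) {σ : N₂} (hσ : σ ∈ leftKernelB Ω N₁ N₂) (x : H2 m (G ⧸ N₂))
    (hx : x ∈ groupB Ω h) : (pairingA Ω h hN).val σ ⟨x, groupB_le_groupA Ω h hx⟩ = 0 := by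
  let K : AddSubgroup (H2 m (G ⧸ N₂)) :=
    (((pairingA Ω h hN) σ).toAdd.ker).map (groupA m h).subtype
  suffices hK : groupB Ω h ≤ K by
    obtain ⟨y, hy, hyx⟩ := hK hx
    have : y = ⟨x, groupB_le_groupA Ω h hx⟩ := Subtype.ext hyx
    rw [← this]
    exact hy
  refine (AddSubgroup.closure_le _).2 ?_
  rintro _ ⟨⟨i, ρbar, -, rfl⟩, hA⟩
  refine ⟨⟨_, hA⟩, ?_, rfl⟩
  exact trgInv_pullback_eq_zero Ω h hN (Ω.ext i) ρbar hA σ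
    fun ρ => mem_T.1 (show ((σ : G) : G ⧸ N₁) ∈ T Ω (G ⧸ N₁) from hσ) i ρ

/-- The pairing `⟨·,·⟩^B` on `N₂/(N₂ ∩ π₁⁻¹[T(G/N₁)]) × B_G(N₁, N₂)` induced by `⟨·,·⟩^A`. -/
def pairingB {N₁ N₂ : Subgroup G} [N₁.Normal] [N₂.Normal] (h : N₁ ≤ N₂) (hN : N₂ ≤ Tbar Ω G) :
    Pairing m (N₂ ⧸ leftKernelB Ω N₁ N₂) (groupB Ω h) :=
  QuotientGroup.lift (leftKernelB Ω N₁ N₂)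
    (MonoidHom.mk' (fun σ => Multiplicative.ofAdd
        ((pairingA Ω h hN σ).toAdd.comp (AddSubgroup.inclusion (groupB_le_groupA Ω h))))
      fun σ τ => by rw [map_mul]; rfl)
    fun _ hσ => Multiplicative.toAdd.injective
      (AddMonoidHom.ext fun x => pairingA_eq_zero Ω h hN hσ x.1 x.2)

/-- The defining property of `⟨·,·⟩^B`. -/
theorem pairingB_mk {N₁ N₂ : Subgroup G} [N₁.Normal] [N₂.Normal] (h : N₁ ≤ N₂)
    (hN : N₂ ≤ Tbar Ω G) (σ : N₂) (x : groupB Ω h) :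
    (pairingB Ω h hN).val (σ : N₂ ⧸ leftKernelB Ω N₁ N₂) x =
      (pairingA Ω h hN).val σ ⟨x.1, groupB_le_groupA Ω h x.2⟩ := rfl

end Pairings

end CPairing

end

open CPairing

/-! ### Duality between compact groups and groups of their `ℤ/p`-valued characters. -/

namespace CPairing

/-! The theorem reduces to linear duality over `ℤ/p` for a group `D` of characters of the compact
group `N₂`. A `π₂`-liftable pullback comes with a lift `ρ : G → U`, and `ρ` kills `T(G)`; hence the
whole liftable part of `H²(G/N₂)` dies in `H²(G/(N₂ ∩ T(G)))`. Inverse transgression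
(`liftableTrgInv`) therefore embeds the liftable part in the continuous homomorphisms `N₂ → ℤ/p`,
with image `D`.

Two facts describe `D`. Its common kernel is `N₂ ∩ T(G)` (`forall_liftableTrgInv_eq_zero_iff`): for
any `ρ : G → U`, the map `λ ∘ ρ` kills `N₂ ≤ T̄(G)`, so it gives a liftable map on `G/N₂`, and the
character of its pullback is, up to sign, `ρ` restricted to `N₂`. Moreover `C_G(N₁, N₂)` corresponds
to the members of `D` vanishing on `N₁` (`mem_groupC_iff`). The C-pairing is evaluation of
characters.

Perfectness then follows from two duality statements: functionals vanishing on the right kernel are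
evaluations (`exists_forall_eq_of_compact`), and `D` contains every continuous character trivial on
its common kernel (`mem_of_forall_eq_zero`). -/

/-- A pairing of an abelian group `M` with a compact group `N`, continuous on `N`, induces every
homomorphism `M → ℤ/p` which vanishes on the right kernel. -/
theorem exists_forall_eq_of_compact {p : ℕ} [Fact p.Prime] {M N : Type*} [AddCommGroup M]
    [Group N] [TopologicalSpace N] [CompactSpace N] (Φ : M →+ N → ZMod p)
    (hcont : ∀ x, Continuous (Φ x)) (hmul : ∀ x a b, Φ x (a * b) = Φ x a + Φ x b)
    (f : M →+ ZMod p) (hf : ∀ x, Φ x = 0 → f x = 0) : ∃ n, ∀ x, Φ x n = f x := by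
  classical
  -- Finitely many values are prescribed first, by linear algebra; compactness of `N` then handles
  -- all of `M`.
  have hfin : ∀ s : Finset M, ∃ n, ∀ x ∈ s, Φ x n = f x := by
    intro s
    let e : Additive N →+ (s → ZMod p) := AddMonoidHom.mk' (fun n x => Φ x n.toMul)
      fun a b => funext fun x => hmul x a.toMul b.toMul
    let R : Submodule (ZMod p) (s → ZMod p) := AddSubgroup.toZModSubmodule p e.range
    -- Otherwise a functional `l` kills the image of `N` but not the vector of prescribed values.
    -- Its coefficients `c` give an element `∑ c x • x` of `M` in the right kernel on which `f` is
    -- nonzero. Since `M` is only an abelian group, the coefficients act through their natural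
    -- representatives.
    have hv : (fun x : s => f x) ∈ R := by
      by_contra hv
      obtain ⟨l, hl, hR⟩ := Submodule.exists_le_ker_of_notMem hv
      let c : s → ZMod p := fun x => l (Pi.single x 1)
      have hlc : ∀ w : s → ZMod p, l w = ∑ x, c x * w x := by
        intro w
        rw [LinearMap.pi_apply_eq_sum_univ l w]
        refine Finset.sum_congr rfl fun x _ => ?_
        rw [smul_eq_mul, mul_comm]
        congr 2
        ext j
        simp [Pi.single_apply, eq_comm]
      apply hl
      have h0 : f (∑ x : s, (c x).val • (x : M)) = 0 := by
        apply hf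
        ext n
        have := hR (show e (Additive.ofMul n) ∈ R from ⟨_, rfl⟩)
        rw [LinearMap.mem_ker, hlc] at this
        rw [map_sum, Finset.sum_apply]
        refine Eq.trans (Finset.sum_congr rfl fun x _ => ?_) this
        rw [map_nsmul]
        change (c x).val • Φ x n = c x * Φ x n
        rw [nsmul_eq_mul, ZMod.natCast_zmod_val]
      rw [hlc]
      simpa [map_sum] using h0
    obtain ⟨n, hn⟩ := hv
    exact ⟨n.toMul, fun x hx => congrFun hn ⟨x, hx⟩⟩
  -- The solution sets are closed, and `hfin` gives the finite intersection property.
  have h := CompactSpace.iInter_nonempty (t := fun x : M => {n : N | Φ x n = f x})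
    (fun x => isClosed_eq (hcont x) continuous_const) fun s => by
      obtain ⟨n, hn⟩ := hfin s
      exact ⟨n, by simpa using hn⟩
  obtain ⟨n, hn⟩ := h
  exact ⟨n, by simpa using hn⟩

/-- A group of continuous homomorphisms `N → ℤ/p` on a compact group contains every continuous
homomorphism which vanishes on its common kernel. -/
theorem mem_of_forall_eq_zero {p : ℕ} [Fact p.Prime] {N : Type*} [Group N] [TopologicalSpace N]
    [CompactSpace N] (D : AddSubgroup C(N, ZMod p))
    (hD : ∀ ψ ∈ D, ∀ a b, ψ (a * b) = ψ a + ψ b) (χ : C(N, ZMod p))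
    (hχ : ∀ a b, χ (a * b) = χ a + χ b) (h0 : ∀ n, (∀ ψ ∈ D, ψ n = 0) → χ n = 0) : χ ∈ D := by
  by_contra hn
  obtain ⟨f, hfχ, hfD⟩ := Submodule.exists_le_ker_of_notMem
    (show χ ∉ AddSubgroup.toZModSubmodule p D from hn)
  -- The separating functional `f` lives on all continuous functions; restricted to `D + ℤχ`, which
  -- consists of homomorphisms, it becomes evaluation at some `n`. Then `D` vanishes at `n`, so `χ n
  -- = 0` by `h0`, against `f χ ≠ 0`.
  let M : AddSubgroup C(N, ZMod p) := D ⊔ AddSubgroup.zmultiples χ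
  have hM : ∀ ψ ∈ M, ∀ a b, ψ (a * b) = ψ a + ψ b := by
    intro ψ hψ a b
    obtain ⟨d, hd, z, hz, rfl⟩ := AddSubgroup.mem_sup.1 hψ
    obtain ⟨k, rfl⟩ := AddSubgroup.mem_zmultiples_iff.1 hz
    simp [hD d hd, hχ]
    ring
  obtain ⟨n, hn⟩ := exists_forall_eq_of_compact
    (ContinuousMap.coeFnAddMonoidHom.comp M.subtype) (fun ψ => ψ.1.continuous)
    (fun ψ => hM ψ ψ.2) (f.toAddMonoidHom.comp M.subtype) (fun ψ hψ => by
      have : ψ.1 = 0 := DFunLike.coe_injective hψ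
      simp [this])
  apply hfχ
  have h1 := hn ⟨χ, AddSubgroup.mem_sup_right (AddSubgroup.mem_zmultiples χ)⟩
  refine h1.symm.trans (h0 n fun ψ hψ => ?_)
  exact (hn ⟨ψ, AddSubgroup.mem_sup_left hψ⟩).trans (hfD hψ)

end CPairing

/-! ### Vanishing under inflation, and lifts of homomorphisms as cochains. -/

namespace CPairing

section Transgression

variable {m : ℕ} {G : Type*} [Group G] [TopologicalSpace G]

/-- A class whose transgression preimage vanishes on `N₁` is killed by inflation to `G/N₁`. -/
theorem IsTransgression.inf_eq_zero {N₁ N₂ : Subgroup G} [N₁.Normal] [N₂.Normal] (h : N₁ ≤ N₂)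
    {ψ : H1inv m N₂} {x : H2 m (G ⧸ N₂)} (hψ : IsTransgression ψ x)
    (h0 : ∀ n : N₂, (n : G) ∈ N₁ → ψ.1 n = 0) : inf h x = 0 := by
  obtain ⟨y, c, hy, hc, rfl⟩ := hψ
  -- The cocycle identity gives `c(a, 1) = c(1, 1)`, which equals `y 1 = ψ 1 = 0`.
  have hc1 : ∀ a : G ⧸ N₂, c.1 (a, 1) = 0 := by
    intro a
    have e := c.2 a 1 1
    have e' := hc 1 1
    have e'' := hy 1
    rw [h0 1 N₁.one_mem] at e''
    simp only [mul_one, QuotientGroup.mk_one, Subgroup.coe_one] at e e' e''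
    linear_combination -e + e' + e''
  -- Hence `y` is constant on cosets of `N₁` and descends to a cochain on `G/N₁` that bounds the
  -- inflated cocycle.
  have hyn : ∀ a n : G, n ∈ N₁ → y (a * n) = y a := by
    intro a n hn
    have e := hc a n
    have e' := hy ⟨n, h hn⟩
    rw [h0 _ hn] at e'
    rw [coe_eq_one_of_mem (h hn), hc1] at e
    linear_combination e + e'
  let z : C(G ⧸ N₁, ZMod m) := ⟨fun g => Quotient.liftOn' g y fun a b hab => by
      have := hyn a (a⁻¹ * b) (QuotientGroup.leftRel_apply.1 hab)
      rw [mul_inv_cancel_left] at this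
      exact this.symm, y.continuous.quotient_liftOn' _⟩
  refine H2.mk_eq_zero.2 ⟨z, fun a b => ?_⟩
  obtain ⟨a, rfl⟩ := QuotientGroup.mk_surjective a
  obtain ⟨b, rfl⟩ := QuotientGroup.mk_surjective b
  exact hc a b

theorem inf_refl (N : Subgroup G) [N.Normal] (x : H2 m (G ⧸ N)) : inf le_rfl x = x := by
  have : projQuot (le_refl N) = ContinuousMonoidHom.id (G ⧸ N) := by
    ext g
    obtain ⟨g, rfl⟩ := QuotientGroup.mk_surjective g
    rfl
  rw [inf, this]
  induction x using QuotientAddGroup.induction_on with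
  | H c => rfl

/-- The homomorphism induced on `G/N` by a continuous homomorphism trivial on `N`. -/
def liftQuot {K : Type*} [Group K] [TopologicalSpace K] (N : Subgroup G) [N.Normal] (ρ : G →ₜ* K)
    (h : ∀ n ∈ N, ρ n = 1) : G ⧸ N →ₜ* K where
  toMonoidHom := QuotientGroup.lift N ρ.toMonoidHom h
  continuous_toFun := (QuotientGroup.isQuotientMap_mk N).continuous_iff.2 ρ.continuous_toFun

end Transgression

/-- A lift of `r : K → Ū` to `U` differs from the section by a cochain whose coboundary is the
pullback of the factor set. -/
theorem CentralExtension.exists_cochain {m : ℕ} [NeZero m] (ω : CentralExtension m) {K : Type*}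
    [Group K] [TopologicalSpace K] (r : K →ₜ* ω.Ubar) (ρ : K →ₜ* ω.U)
    (h : ∀ a, ω.lam (ρ a) = r a) :
    ∃ z : C(K, ZMod m), (∀ a b, ω.factor (r a, r b) = z b - z (a * b) + z a) ∧
      ∀ a, ρ a = ω.incl (Multiplicative.ofAdd (-z a)) * ω.sec (r a) := by
  have hex : ∀ a, ∃ z : ZMod m, ω.incl (Multiplicative.ofAdd z) = ω.sec (r a) * (ρ a)⁻¹ := by
    intro a
    have : ω.sec (r a) * (ρ a)⁻¹ ∈ ω.incl.range := by
      rw [ω.exact]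
      change ω.lam _ = 1
      simp [ω.lam_sec, h]
    obtain ⟨z, hz⟩ := this
    exact ⟨z.toAdd, hz⟩
  choose z hz using hex
  have hzc : Continuous z := by
    rw [ω.isEmbedding_incl.continuous_iff]
    have : (fun z : ZMod m => ω.incl (Multiplicative.ofAdd z)) ∘ z =
        fun a => ω.sec (r a) * (ρ a)⁻¹ := funext hz
    rw [this]
    fun_prop
  have hz' : ∀ a, ω.sec (r a) = ω.incl (Multiplicative.ofAdd (z a)) * ρ a := by
    intro a; rw [hz, inv_mul_cancel_right]
  refine ⟨⟨z, hzc⟩, fun a b => ?_, fun a => ?_⟩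
  · have h1 := ω.factor_spec (r a) (r b)
    rw [← map_mul r, hz' a, hz' b, hz' (a * b), mul_assoc, ← mul_assoc (ρ a), ω.incl_comm,
      mul_assoc, ← map_mul ρ, ← mul_assoc, ← mul_assoc, mul_left_inj, ← map_mul ω.incl,
      ← map_mul ω.incl, ← ofAdd_add, ← ofAdd_add] at h1
    have h2 := Multiplicative.ofAdd.injective (ω.incl_injective h1)
    change ω.factor (r a, r b) = z b - z (a * b) + z a
    linear_combination -h2
  · simp [hz' a]

/-! ### The characters of `N` attached to the liftable part. -/

section

variable {m : ℕ} [NeZero m] {ι : Type*} (Ω : ExtensionFamily m ι)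
  {G : Type*} [Group G] [TopologicalSpace G]

/-- Both preimages are given on `N₂` by the same cochain of `G/N₁`, through `transgression_formula`.
No vanishing on `N₁` is required of them, so preimages chosen relative to different subgroups can be
compared. -/
theorem IsTransgression.unique {N₁ N₂ : Subgroup G} [N₁.Normal] [N₂.Normal] (h : N₁ ≤ N₂)
    (hN : N₂ ≤ Tbar Ω G) {ψ ψ' : H1inv m N₂} {x : H2 m (G ⧸ N₂)} (hψ : IsTransgression ψ x)
    (hψ' : IsTransgression ψ' x) (hx : x ∈ groupA m h) : ψ = ψ' := by
  induction x using QuotientAddGroup.induction_on with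
  | H c =>
  obtain ⟨z, hz⟩ := H2.mk_eq_zero.1 (show H2.mk (cocyclesMap (projQuot h) c) = 0 from hx)
  refine Subtype.ext (ContinuousMap.ext fun n => ?_)
  rw [transgression_formula Ω h hN c z hz ψ hψ n, transgression_formula Ω h hN c z hz ψ' hψ' n]

/-- A liftable pullback vanishes after inflation to `G/(N ∩ T(G))`. -/
theorem liftablePullbacks_subset_groupA (N : Subgroup G) [N.Normal] :
    liftablePullbacks Ω N ⊆ groupA m (inf_le_left : N ⊓ T Ω G ≤ N) := by
  rintro _ ⟨i, ρbar, ⟨ρ, hρ⟩, rfl⟩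
  -- The lift `ρ` kills `T(G)`, so it descends to `G/(N ∩ T(G))` and there lifts the inflation of
  -- `ρbar`; the resulting cochain bounds the pulled-back factor set.
  obtain ⟨z, hz, -⟩ := (Ω.ext i).exists_cochain (ρbar.comp (projQuot inf_le_left))
    (liftQuot (N ⊓ T Ω G) ρ fun n hn => mem_T.1 hn.2 i ρ) fun a => by
      obtain ⟨a, rfl⟩ := QuotientGroup.mk_surjective a
      exact hρ a
  exact H2.mk_eq_zero.2 ⟨z, hz⟩

theorem liftablePart_le_groupB (N : Subgroup G) [N.Normal] :
    liftablePart Ω N ≤ groupB Ω (inf_le_left : N ⊓ T Ω G ≤ N) :=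
  AddSubgroup.closure_mono fun _ hx => ⟨hx, liftablePullbacks_subset_groupA Ω N hx⟩

theorem groupB_le_liftablePart {N₁ N₂ : Subgroup G} [N₁.Normal] [N₂.Normal] (h : N₁ ≤ N₂) :
    groupB Ω h ≤ liftablePart Ω N₂ :=
  AddSubgroup.closure_mono Set.inter_subset_left

theorem liftablePart_le_groupA (N : Subgroup G) [N.Normal] :
    liftablePart Ω N ≤ groupA m (inf_le_left : N ⊓ T Ω G ≤ N) :=
  (liftablePart_le_groupB Ω N).trans (groupB_le_groupA Ω _)

variable {N : Subgroup G} [N.Normal] (hN : N ≤ Tbar Ω G)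

/-- The transgression preimage, as a continuous function on `N`, of an element of `H²(G/N)_π`. -/
noncomputable def liftableTrgInv : liftablePart Ω N →+ C(N, ZMod m) :=
  AddMonoidHom.mk' (fun x => (trgInv Ω (inf_le_left : N ⊓ T Ω G ≤ N) hN
      ⟨x.1, liftablePart_le_groupA Ω N x.2⟩).1) fun x x' => by
    rw [← AddSubgroup.coe_add, ← trgInv_add]
    rfl

theorem liftableTrgInv_mul (x : liftablePart Ω N) (a b : N) :
    liftableTrgInv Ω hN x (a * b) = liftableTrgInv Ω hN x a + liftableTrgInv Ω hN x b :=
  (mem_H1inv.1 (trgInv Ω (inf_le_left : N ⊓ T Ω G ≤ N) hN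
    ⟨x.1, liftablePart_le_groupA Ω N x.2⟩).2).1 a b

/-- The character was chosen relative to `N ∩ T(G)`; this independence of the smaller subgroup makes
the C-pairing agree with the B-pairing for `N₁`. -/
theorem liftableTrgInv_eq_trgInv {N₁ : Subgroup G} [N₁.Normal] (h : N₁ ≤ N)
    (x : liftablePart Ω N) (hx : x.1 ∈ groupA m h) :
    liftableTrgInv Ω hN x = (trgInv Ω h hN ⟨x.1, hx⟩).1 :=
  congrArg Subtype.val <| IsTransgression.unique Ω h hN
    (trgInv_spec Ω inf_le_left hN ⟨x.1, liftablePart_le_groupA Ω N x.2⟩).2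
    (trgInv_spec Ω h hN ⟨x.1, hx⟩).2 hx

/-- The elements of the liftable part which inflate to zero in `H²(G/N₁)` are those whose
transgression preimage vanishes on `N₁`. -/
theorem mem_groupC_iff {N₁ : Subgroup G} [N₁.Normal] (h : N₁ ≤ N) (x : liftablePart Ω N) :
    x ∈ groupC Ω h ↔ ∀ n : N, (n : G) ∈ N₁ → liftableTrgInv Ω hN x n = 0 := by
  have key : x ∈ groupC Ω h ↔ x.1 ∈ groupA m h := Subtype.ext_iff
  rw [key]
  constructor
  · intro hx
    rw [liftableTrgInv_eq_trgInv Ω hN h x hx]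
    exact (trgInv_spec Ω h hN ⟨x.1, hx⟩).1
  · exact (trgInv_spec Ω inf_le_left hN ⟨x.1, liftablePart_le_groupA Ω N x.2⟩).2.inf_eq_zero h

/-- A zero character vanishes on all of `N`, so its class dies under inflation from `G/N` to itself,
which is the identity. -/
theorem liftableTrgInv_injective : Function.Injective (liftableTrgInv Ω hN) := by
  refine (injective_iff_map_eq_zero _).2 fun x hx => ?_
  have h0 : x.1 = inf le_rfl x.1 := (inf_refl N x.1).symm
  rw [IsTransgression.inf_eq_zero le_rfl (trgInv_spec Ω inf_le_left hN
    ⟨x.1, liftablePart_le_groupA Ω N x.2⟩).2 fun n _ => DFunLike.congr_fun hx n] at h0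
  exact Subtype.ext h0

/-- The common kernel of the transgression preimages of the liftable part is `N ∩ T(G)`. -/
theorem forall_liftableTrgInv_eq_zero_iff (σ : N) :
    (∀ x, liftableTrgInv Ω hN x σ = 0) ↔ (σ : G) ∈ T Ω G := by
  constructor
  · refine fun hσ => mem_T.2 fun i ρ => ?_
    -- `λ ∘ ρ` takes values in `Ū`, so it is trivial on `N ≤ T̄(G)`. By construction `ρ` is a lift
    -- of `ρbar`.
    let ρbar : G ⧸ N →ₜ* (Ω.ext i).Ubar := liftQuot N ((Ω.ext i).lam.comp ρ)
      fun n hn => mem_Tbar.1 (hN hn) i _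
    have hx : H2.map ρbar (Ω.ext i).alpha ∈ liftablePullbacks Ω N :=
      ⟨i, ρbar, ⟨ρ, fun g => rfl⟩, rfl⟩
    let ρ' := liftQuot (N ⊓ T Ω G) ρ fun n hn => mem_T.1 hn.2 i ρ
    obtain ⟨z, hz, hρ⟩ := (Ω.ext i).exists_cochain (ρbar.comp (projQuot inf_le_left)) ρ'
      fun a => by
        obtain ⟨a, rfl⟩ := QuotientGroup.mk_surjective a
        rfl
    have e : liftableTrgInv Ω hN ⟨_, AddSubgroup.subset_closure hx⟩ σ =
        z ((σ : G) : G ⧸ (N ⊓ T Ω G)) - z 1 :=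
      transgression_formula Ω inf_le_left hN (cocyclesMap ρbar (Ω.ext i).cocycle) z hz _
        (trgInv_spec Ω inf_le_left hN _).2 σ
    rw [hσ] at e
    have hr : ρbar.comp (projQuot (inf_le_left : N ⊓ T Ω G ≤ N)) ((σ : G) : G ⧸ (N ⊓ T Ω G)) =
        ρbar.comp (projQuot (inf_le_left : N ⊓ T Ω G ≤ N)) 1 := by
      change ρbar ((σ : G) : G ⧸ N) = ρbar ((1 : G) : G ⧸ N)
      rw [coe_eq_one_of_mem σ.2, QuotientGroup.mk_one]
    calc ρ σ = ρ' ((σ : G) : G ⧸ (N ⊓ T Ω G)) := rfl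
      -- Both factors of `ρ' = incl(-z) · sec(r)` agree at `σ` and at `1`: `z` because the character
      -- vanishes at `σ`, and `r` because `σ ∈ N`.
      _ = ρ' 1 := by rw [hρ, hρ, hr, sub_eq_zero.1 e.symm]
      _ = 1 := map_one _
  · exact fun hσ x => (trgInv_spec Ω inf_le_left hN
      ⟨x.1, liftablePart_le_groupA Ω N x.2⟩).1 σ ⟨σ.2, hσ⟩

end
end CPairing

/-! ### The C-pairing and its perfectness. -/

namespace CPairing

section

variable {p : ℕ} [Fact p.Prime] {ι : Type*} (Ω : ExtensionFamily p ι)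
  {G : Type*} [Group G] [TopologicalSpace G] {N₁ N₂ : Subgroup G} [N₁.Normal] [N₂.Normal]
  (h : N₁ ≤ N₂) (hN : N₂ ≤ Tbar Ω G)

/-- Split `σ = n t` with `n ∈ N₁` and `t ∈ T(G)`; then `t` lies in `N₂` as well. Characters from
`C_G(N₁, N₂)` kill `n`, and all characters of the liftable part kill `t`. -/
theorem liftableTrgInv_eq_zero_of_mem_sup {σ : N₂} (hσ : (σ : G) ∈ N₁ ⊔ T Ω G)
    {x : liftablePart Ω N₂} (hx : x ∈ groupC Ω h) : liftableTrgInv Ω hN x σ = 0 := by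
  obtain ⟨n, hn, t, ht, hnt⟩ := Subgroup.mem_sup_of_normal_left.1 hσ
  have ht2 : t ∈ N₂ := by
    rw [← inv_mul_cancel_left n t, hnt]
    exact N₂.mul_mem (N₂.inv_mem (h hn)) σ.2
  have e : σ = ⟨n, h hn⟩ * ⟨t, ht2⟩ := Subtype.ext hnt.symm
  rw [e, liftableTrgInv_mul, (mem_groupC_iff Ω hN h x).1 hx _ hn,
    (forall_liftableTrgInv_eq_zero_iff Ω hN ⟨t, ht2⟩).2 ht x, add_zero]

/-- The pairing on `N₂/(N₂ ∩ N₁T(G)) × C_G(N₁, N₂)`. -/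
noncomputable def pairingC :
    Pairing p (N₂ ⧸ (N₁ ⊔ T Ω G).subgroupOf N₂) (groupC Ω h) :=
  QuotientGroup.lift _
    (MonoidHom.mk' (fun σ => Multiplicative.ofAdd (AddMonoidHom.mk'
        (fun x : groupC Ω h => liftableTrgInv Ω hN x.1 σ) fun x x' => by
          rw [AddSubgroup.coe_add, map_add]; rfl))
      fun σ τ => Multiplicative.toAdd.injective
        (AddMonoidHom.ext fun x => liftableTrgInv_mul Ω hN x.1 σ τ))
    fun _ hσ => Multiplicative.toAdd.injective (AddMonoidHom.ext fun x =>
      liftableTrgInv_eq_zero_of_mem_sup Ω h hN (Subgroup.mem_subgroupOf.1 hσ) x.2)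

theorem pairingC_val_eq_pairingB_val (σ : N₂) (x : groupC Ω h) (hx : x.1.1 ∈ groupB Ω h) :
    (pairingC Ω h hN).val σ x = (pairingB Ω h hN).val σ ⟨x.1.1, hx⟩ := by
  have e := liftableTrgInv_eq_trgInv Ω hN h x.1 (groupB_le_groupA Ω h hx)
  exact DFunLike.congr_fun e σ

theorem pairingC_isPerfect [IsTopologicalGroup G] [CompactSpace G]
    (hN₁ : IsClosed (N₁ : Set G)) (hN₂ : IsClosed (N₂ : Set G)) :
    (pairingC Ω h hN).IsPerfect where
  continuous_left x := (QuotientGroup.isQuotientMap_mk _).continuous_iff.2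
    (liftableTrgInv Ω hN x.1).continuous
  injective_left a a' haa := by
    obtain ⟨σ, rfl⟩ := QuotientGroup.mk_surjective a
    obtain ⟨τ, rfl⟩ := QuotientGroup.mk_surjective a'
    have : CompactSpace N₁ := isCompact_iff_compactSpace.1 hN₁.isCompact
    let i : N₁ → N₂ := Subgroup.inclusion h
    have hi : Continuous i := continuous_inclusion h
    have hinv : ∀ (x : liftablePart Ω N₂) (a b : N₂), liftableTrgInv Ω hN x (a⁻¹ * b) =
        liftableTrgInv Ω hN x b - liftableTrgInv Ω hN x a := by
      intro x a b
      have := liftableTrgInv_mul Ω hN x a (a⁻¹ * b)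
      rw [mul_inv_cancel_left] at this
      linear_combination -this
    -- The duality is applied to the whole liftable part paired with `N₁`, whose right kernel is
    -- `C_G(N₁, N₂)`. Evaluation at `σ⁻¹τ` vanishes there by `haa`, so it coincides with evaluation
    -- at some `n ∈ N₁`.
    let Φ : liftablePart Ω N₂ →+ N₁ → ZMod p := AddMonoidHom.mk'
      (fun x n => liftableTrgInv Ω hN x (i n)) fun x y => by rw [map_add]; rfl
    let f : liftablePart Ω N₂ →+ ZMod p := AddMonoidHom.mk'
      (fun x => liftableTrgInv Ω hN x (σ⁻¹ * τ)) fun x y => by rw [map_add]; rfl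
    obtain ⟨n, hn⟩ := exists_forall_eq_of_compact Φ
      (fun x => (liftableTrgInv Ω hN x).continuous.comp hi)
      (fun x a b => liftableTrgInv_mul Ω hN x (i a) (i b)) f fun x hx => by
        have hxC : x ∈ groupC Ω h :=
          (mem_groupC_iff Ω hN h x).2 fun n hn => congrFun hx ⟨n, hn⟩
        exact (hinv x σ τ).trans (sub_eq_zero.2 (haa ⟨x, hxC⟩).symm)
    -- Every character of the liftable part kills `n⁻¹σ⁻¹τ`, which forces `σ⁻¹τ ∈ N₁T(G)`.
    have hT : (((i n)⁻¹ * (σ⁻¹ * τ) : N₂) : G) ∈ T Ω G :=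
      (forall_liftableTrgInv_eq_zero_iff Ω hN _).1 fun x =>
        (hinv x _ _).trans (sub_eq_zero.2 (hn x).symm)
    refine QuotientGroup.eq.2 (Subgroup.mem_subgroupOf.2 ?_)
    have := Subgroup.mul_mem_sup n.2 hT
    rwa [Subgroup.coe_mul, Subgroup.coe_inv, show ((i n : N₂) : G) = n from rfl,
      mul_inv_cancel_left] at this
  surjective_left f := by
    have : CompactSpace N₂ := isCompact_iff_compactSpace.1 hN₂.isCompact
    obtain ⟨n, hn⟩ := exists_forall_eq_of_compact
      (ContinuousMap.coeFnAddMonoidHom.comp ((liftableTrgInv Ω hN).comp (groupC Ω h).subtype))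
      (fun x => (liftableTrgInv Ω hN x.1).continuous)
      (fun x => liftableTrgInv_mul Ω hN x.1) f fun x hx => by
        have hx0 : x.1 = 0 := liftableTrgInv_injective Ω hN
          ((DFunLike.coe_injective hx).trans (map_zero _).symm)
        rw [show x = 0 from Subtype.ext hx0, map_zero]
    exact ⟨n, hn⟩
  injective_right x y hxy := Subtype.ext <| liftableTrgInv_injective Ω hN <|
    ContinuousMap.ext fun σ => hxy σ
  surjective_right χ := by
    have : CompactSpace N₂ := isCompact_iff_compactSpace.1 hN₂.isCompact
    let χ' : C(N₂, ZMod p) := ⟨fun σ => (χ σ).toAdd,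
      continuous_of_discreteTopology.comp (χ.continuous_toFun.comp QuotientGroup.continuous_mk)⟩
    have h0 : ∀ σ : N₂, (σ : G) ∈ N₁ ⊔ T Ω G → χ' σ = 0 := by
      intro σ hσ
      have : (σ : N₂ ⧸ (N₁ ⊔ T Ω G).subgroupOf N₂) = 1 :=
        (QuotientGroup.eq_one_iff σ).2 (Subgroup.mem_subgroupOf.2 hσ)
      change (χ σ).toAdd = 0
      rw [this, map_one]
      rfl
    -- Triviality on `N₂ ∩ T(G)`, the common kernel of the range, makes `χ'` the character of a
    -- liftable class; triviality on `N₁` then places that class in `C_G(N₁, N₂)`.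
    have hχ : χ' ∈ (liftableTrgInv Ω hN).range := by
      refine mem_of_forall_eq_zero _ ?_ χ' (fun a b => ?_) fun σ hσ => ?_
      · rintro _ ⟨x, rfl⟩
        exact liftableTrgInv_mul Ω hN x
      · change (χ ((a * b : N₂) : N₂ ⧸ _)).toAdd = _
        rw [QuotientGroup.mk_mul, map_mul]
        rfl
      · exact h0 σ (Subgroup.mem_sup_right
          ((forall_liftableTrgInv_eq_zero_iff Ω hN σ).1 fun x => hσ _ ⟨x, rfl⟩))
    obtain ⟨x, hx⟩ := hχ
    refine ⟨⟨x, (mem_groupC_iff Ω hN h x).2 fun n hn => ?_⟩, fun a => ?_⟩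
    · rw [hx]
      exact h0 n (Subgroup.mem_sup_left hn)
    · obtain ⟨σ, rfl⟩ := QuotientGroup.mk_surjective a
      exact DFunLike.congr_fun hx σ

end

end CPairing

theorem theorem7p1 {p : ℕ} [Fact p.Prime] {ι : Type*} (Ω : ExtensionFamily p ι)
    {G : Type*} [Group G] [TopologicalSpace G] [IsTopologicalGroup G] [CompactSpace G]
    [TotallyDisconnectedSpace G] (N₁ N₂ : Subgroup G) [N₁.Normal] [N₂.Normal]
    (hN₁ : IsClosed (N₁ : Set G)) (hN₂ : IsClosed (N₂ : Set G))
    (h : N₁ ≤ N₂) (hT : N₂ ≤ Tbar Ω G) :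
    ∃! β : Pairing p (N₂ ⧸ (N₁ ⊔ T Ω G).subgroupOf N₂) (groupC Ω h),
      (∀ (σ : N₂) (x : groupC Ω h),
        ∃ hx : ((x : liftablePart Ω N₂) : H2 p (G ⧸ N₂)) ∈
            groupB Ω (inf_le_left : N₂ ⊓ T Ω G ≤ N₂),
          β.val σ x = (pairingB Ω (inf_le_left : N₂ ⊓ T Ω G ≤ N₂) hT).val σ ⟨_, hx⟩) ∧
      (∀ (σ : N₂) (x : groupB Ω h),
        ∃ y : groupC Ω h, ((y : liftablePart Ω N₂) : H2 p (G ⧸ N₂)) = x ∧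
          β.val σ y = (pairingB Ω h hT).val σ x) ∧
      β.IsPerfect := by
  have hval : ∀ (σ : N₂) (x : groupC Ω h),
      ∃ hx : ((x : liftablePart Ω N₂) : H2 p (G ⧸ N₂)) ∈
          groupB Ω (inf_le_left : N₂ ⊓ T Ω G ≤ N₂),
        (pairingC Ω h hT).val σ x =
          (pairingB Ω (inf_le_left : N₂ ⊓ T Ω G ≤ N₂) hT).val σ ⟨_, hx⟩ :=
    -- The values agree by definition, since `liftableTrgInv` uses the transgression preimage
    -- relative to `N₂ ∩ T(G)`.
    fun σ x => ⟨liftablePart_le_groupB Ω N₂ x.1.2, rfl⟩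
  refine ⟨pairingC Ω h hT, ⟨hval, fun σ x => ?_, pairingC_isPerfect Ω h hT hN₁ hN₂⟩, ?_⟩
  · let y : liftablePart Ω N₂ := ⟨x.1, groupB_le_liftablePart Ω h x.2⟩
    have hy : y ∈ groupC Ω h := Subtype.ext (groupB_le_groupA Ω h x.2)
    exact ⟨⟨y, hy⟩, rfl, pairingC_val_eq_pairingB_val Ω h hT σ ⟨y, hy⟩ x.2⟩
  -- The first compatibility already prescribes every value of `β`.
  · rintro β ⟨hβ, -, -⟩
    refine MonoidHom.ext fun a => Multiplicative.toAdd.injective (AddMonoidHom.ext fun x => ?_)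
    obtain ⟨σ, rfl⟩ := QuotientGroup.mk_surjective a
    exact (hβ σ x).choose_spec.trans (hval σ x).choose_spec.symm
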